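/- Let $(B_n)_{n\ge 0}$ be the sequence of balancing numbers, $B_0=0$, $B_1=1$, $B_{n+1}=6B_n-B_{n-1}$ for $n\ge 1$. An odd prime $p$ is called a balancing non-Wieferich prime if $B_{p-\left(\frac{8}{p}\right)}\not\equiv 0 \pmod{p^2}$, where $\left(\frac{8}{p}\right)$ is the Jacobi symbol. For a number field $K$ with ring of integers $\mathcal{O}_K$ and $a,b,c\in K^*$, let $$H_K(a,b,c)=\prod_{v}\max(\|a\|_v,\|b\|_v,\|c\|_v),$$ the product running over all places $v$ of $K$, where $\|x\|_v=N(\mathfrak p)^{-v_{\mathfrak p}(x)}$ if $v$ is given by a nonzero prime ideal $\mathfrak p$ of $\mathcal{O}_K$ with absolute norm $N(\mathfrak p)$, $\|x\|_v=|\rho(x)|$ if $v$ is given by a real embedding $\rho$, and $\|x\|_v=|\rho(x)|^2$ if $v$ is given by a pair of conjugate complex embeddings $\rho,\bar\rho$. Let $$\mathrm{rad}_K(a,b,c)=\prod_{\mathfrak p\in I_K(a,b,c)}N(\mathfrak p)^{v_{\mathfrak p}(p)},$$ where $p$ is the rational prime below $\mathfrak p$ and $I_K(a,b,c)$ is the set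 of nonzero prime ideals $\mathfrak p$ of $\mathcal{O}_K$ for which $\|a\|_{\mathfrak p},\|b\|_{\mathfrak p},\|c\|_{\mathfrak p}$ are not all equal. The $abc$ conjecture for $K$ states that for every $\varepsilon>0$ there is a constant $C=C(\varepsilon,K)>0$ such that $H_K(a,b,c)\le C\,\mathrm{rad}_K(a,b,c)^{1+\varepsilon}$ for all $a,b,c\in K^*$ with $a+b+c=0$. Theorem. Let $r\ge 2$ be an integer and assume the $abc$ conjecture for the number field $\mathbb{Q}(\sqrt2)$. Then there are constants $c>0$ and $x_0$, which may depend on $r$, such that for all real $x\ge x_0$ $$\#\left\{p\le x \text{ an odd prime}: p\equiv 1 \pmod r,\ B_{p-\left(\frac{8}{p}\right)}\not\equiv 0 \pmod{p^2}\right\}\ge c\log x.$$ -/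

import Mathlib

open scoped NumberField IntermediateField

noncomputable section

/-- The balancing numbers: `B 0 = 0`, `B 1 = 1`, `B (n + 2) = 6 * B (n + 1) - B n`. -/
def balancing : ℕ → ℤ
  | 0 => 0
  | 1 => 1
  | n + 2 => 6 * balancing (n + 1) - balancing n

/-- An odd prime `p` is a balancing non-Wieferich prime if `p ^ 2` does not divide
`B (p - (8 / p))`, with `(8 / p)` the Jacobi symbol. The index `p - (8 / p)` is an integer
that is at least `p - 1 > 0`, so `Int.toNat` does not truncate. -/
def IsBalancingNonWieferich (p : ℕ) : Prop :=
  p.Prime ∧ Odd p ∧ ¬ balancing ((p : ℤ) - jacobiSym 8 p).toNat ≡ 0 [ZMOD (p : ℤ) ^ 2]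

/-- The number of primes `p ≤ x` with `p ≡ 1 (mod r)` that are balancing non-Wieferich. -/
def balancingNonWieferichCount (r : ℕ) (x : ℝ) : ℕ :=
  {p : ℕ | (p : ℝ) ≤ x ∧ p ≡ 1 [MOD r] ∧ IsBalancingNonWieferich p}.ncard

section ABC

variable (K : Type*) [Field K] [NumberField K]

/-- The primes `𝔭` of `𝓞 K` at which `‖a‖_𝔭, ‖b‖_𝔭, ‖c‖_𝔭` are not all equal. -/
def badPrimes (a b c : K) : Set (IsDedekindDomain.HeightOneSpectrum (𝓞 K)) :=
  {𝔭 | ¬ (NumberField.FinitePlace.mk 𝔭 a = NumberField.FinitePlace.mk 𝔭 b ∧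
    NumberField.FinitePlace.mk 𝔭 b = NumberField.FinitePlace.mk 𝔭 c)}

/-- The radical of a triple: the product of `N(𝔭) ^ v_𝔭(p)` over the primes `𝔭` at which the
triple does not have constant absolute value. Here `p` is the rational prime below `𝔭`, so
`v_𝔭(p)` is the ramification index of `𝔭` over `ℤ`. -/
def radTriple (a b c : K) : ℝ :=
  ∏ᶠ 𝔭 ∈ badPrimes K a b c,
    ((Ideal.absNorm 𝔭.asIdeal : ℝ) ^ 𝔭.asIdeal.ramificationIdx ℤ)

/-- Only finitely many primes enter the radical of a triple of nonzero elements, so the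
product defining `radTriple` is a genuine finite product. -/
theorem finite_badPrimes {a b c : K} (ha : a ≠ 0) (hb : b ≠ 0) (hc : c ≠ 0) :
    (badPrimes K a b c).Finite := by
  have key : ∀ {x : K}, x ≠ 0 → {𝔭 : IsDedekindDomain.HeightOneSpectrum (𝓞 K) |
      NumberField.FinitePlace.mk 𝔭 x ≠ 1}.Finite := by
    intro x hx
    have h := NumberField.FinitePlace.hasFiniteMulSupport hx
    exact h.preimage (f := NumberField.FinitePlace.mk)
      (fun _ _ _ _ h => NumberField.FinitePlace.mk_eq_iff.mp h)
  refine ((key ha).union ((key hb).union (key hc))).subset ?_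
  intro 𝔭 h
  by_contra h'
  simp only [Set.mem_union, Set.mem_ofPred_eq, not_or, not_not] at h'
  exact h ⟨h'.1.trans h'.2.1.symm, h'.2.1.trans h'.2.2.symm⟩

/-- The `abc` conjecture for the number field `K`. Here `Height.mulHeight ![a, b, c]` is the
relative multiplicative height: the product over all places `v` of `K` of
`max (‖a‖_v) (‖b‖_v) (‖c‖_v)`, with `‖·‖_v = N(𝔭) ^ (- v_𝔭(·))` at a finite place, and
`‖·‖_v = |ρ(·)|`, respectively `|ρ(·)| ^ 2`, at a real, respectively complex, place
(see `NumberField.mulHeight_eq`). -/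
def ABCConjecture : Prop :=
  ∀ ε : ℝ, 0 < ε → ∃ C : ℝ, 0 < C ∧ ∀ a b c : K, a ≠ 0 → b ≠ 0 → c ≠ 0 → a + b + c = 0 →
    Height.mulHeight ![a, b, c] ≤ C * radTriple K a b c ^ (1 + ε)

end ABC

/-- The field `ℚ(√2)` is a number field. -/
instance numberField_adjoin_sqrt_two : NumberField ℚ⟮(√2 : ℝ)⟯ where
  to_charZero := inferInstance
  to_finiteDimensional := by
    apply IntermediateField.adjoin.finiteDimensional
    refine ⟨Polynomial.X ^ 2 - Polynomial.C 2, Polynomial.monic_X_pow_sub_C _ (by norm_num), ?_⟩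
    simp

end

/-! Let α = 3 + √8, a unit of norm 1 in ℤ[√8]. Then B_n is the √8-coordinate of α^n and α^(2n) - 1 =
2√8 · B_n · α^n, so divisibility of balancing numbers is governed by the powers of α^2. Let N be the
absolute norm of Φ_n(α^2). It divides 32 B_n^2 and is at least 32^φ(n).

Call a prime p simple primitive for n if p divides B_n exactly once and divides no B_d with d a
proper divisor of n. For 4 ∣ n, a prime p ∣ N with p^2 ∤ B_n is simple primitive
(`isSimplePrimitive_of_dvd_norm_cyclo`). If there were none, N would be at most 32 (B_n / R)^4,
where R is the radical of B_n. But abc applied to α^(2n) - 1 + (1 - α^(2n)) = 0 forces R to be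
almost as large as α^n ≥ B_n, so N would be too small once φ(n) ≥ δn and n is large
(`exists_isSimplePrimitive`).

When 8 ∣ n, a simple primitive p satisfies (8/p) = 1 and n ∣ p - 1. Since p does not divide (p -
1)/n, p^2 does not divide B_{p-1}. Taking n = 8rk gives p ≡ 1 (mod r). Distinct n give distinct p, p
≤ B_n ≤ α^n, and a positive proportion of k have φ(k) ≥ k/4, so at least a constant times log x such
primes lie below x. -/

open Polynomial in
theorem cyclotomic_dvd_geom_sum {d n : ℕ} (hd : d ∈ n.properDivisors) :
    cyclotomic n ℤ ∣ ∑ j ∈ Finset.range (n / d), (X ^ d : ℤ[X]) ^ j := by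
  have hdn := (Nat.mem_properDivisors.1 hd).1
  have hd0 : d ≠ 0 := (Nat.pos_of_mem_properDivisors hd).ne'
  have h := X_pow_sub_one_mul_cyclotomic_dvd_X_pow_sub_one_of_dvd ℤ hd
  have e : (X ^ n - 1 : ℤ[X]) =
      (X ^ d - 1) * ∑ j ∈ Finset.range (n / d), (X ^ d : ℤ[X]) ^ j := by
    rw [mul_geom_sum, ← pow_mul, Nat.mul_div_cancel' hdn]
  rw [e] at h
  exact (mul_dvd_mul_iff_left (X_pow_sub_C_ne_zero (Nat.pos_of_ne_zero hd0) 1)).1 (by simpa using h)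

/-! ### Powers of 3 + √8 and quotients of balancing numbers. -/

namespace Balancing

open Zsqrtd

/-- The unit `3 + √8` of `ℤ[√8]`. -/
def unit : ℤ√8 := ⟨3, 1⟩

theorem unit_mul_star : unit * star unit = 1 := by decide

theorem unit_pow_mul_star (n : ℕ) : unit ^ n * star (unit ^ n) = 1 := by
  rw [star_pow, ← mul_pow, unit_mul_star, one_pow]

theorem unit_pow_add_two (n : ℕ) : unit ^ (n + 2) = 6 * unit ^ (n + 1) - unit ^ n := by
  have : unit ^ 2 = 6 * unit - 1 := by decide
  rw [pow_add, this, pow_succ]; ring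

theorem im_unit_pow (n : ℕ) : (unit ^ n).im = balancing n := by
  induction n using Nat.strong_induction_on with
  | _ n ih =>
    match n, ih with
    | 0, _ => rfl
    | 1, _ => rfl
    | n + 2, ih =>
      rw [unit_pow_add_two, balancing, im_sub, ih n (by omega), im_mul, ih (n + 1) (by omega)]
      simp

theorem unit_pow_sub_star (n : ℕ) :
    unit ^ n - star (unit ^ n) = 2 * sqrtd * (balancing n : ℤ√8) := by
  rw [← im_unit_pow]
  generalize unit ^ n = a
  ext <;> simp; ring

theorem unit_pow_two_mul_sub_one (n : ℕ) :
    unit ^ (2 * n) - 1 = 2 * sqrtd * ((balancing n : ℤ√8) * unit ^ n) := by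
  have := unit_pow_sub_star n
  have h := unit_pow_mul_star n
  rw [two_mul, pow_add]
  linear_combination unit ^ n * this + h

theorem two_sqrtd_mul_cancel {a b : ℤ√8} (h : 2 * sqrtd * a = 2 * sqrtd * b) : a = b := by
  have h1 := congrArg Zsqrtd.re h
  have h2 := congrArg Zsqrtd.im h
  simp at h1 h2
  ext <;> omega

theorem norm_unit_pow (n : ℕ) : (unit ^ n).norm = 1 := by
  induction n with
  | zero => simp
  | succ n ih => rw [pow_succ, Zsqrtd.norm_mul, ih]; decide

/-- The quotient `B_{dm} / B_d`, up to a unit. -/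
def quot (d m : ℕ) : ℤ√8 := ∑ j ∈ Finset.range m, (unit ^ (2 * d)) ^ j

theorem balancing_mul_unit_pow (d m : ℕ) :
    (balancing (d * m) : ℤ√8) * unit ^ (d * m) = balancing d * unit ^ d * quot d m := by
  apply two_sqrtd_mul_cancel
  have h := mul_geom_sum (unit ^ (2 * d)) m
  rw [← pow_mul, mul_assoc 2 d m, unit_pow_two_mul_sub_one, unit_pow_two_mul_sub_one] at h
  rw [← h, quot]; ring

theorem balancing_mul (d m : ℕ) :
    (balancing (d * m) : ℤ√8) =
      balancing d * (unit ^ d * star (unit ^ (d * m)) * quot d m) := by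
  have h := balancing_mul_unit_pow d m
  have h1 := unit_pow_mul_star (d * m)
  linear_combination star (unit ^ (d * m)) * h - (balancing (d * m) : ℤ√8) * h1

theorem balancing_dvd {d n : ℕ} (h : d ∣ n) : balancing d ∣ balancing n := by
  obtain ⟨m, rfl⟩ := h
  exact (Zsqrtd.intCast_dvd_intCast _ _).1 (Dvd.intro _ (balancing_mul d m).symm)

theorem dvd_unit_pow_sub_one {p : ℤ} {d : ℕ} (h : p ∣ balancing d) :
    (p : ℤ√8) ∣ unit ^ (2 * d) - 1 := by
  rw [unit_pow_two_mul_sub_one]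
  exact Dvd.dvd.mul_left (Dvd.dvd.mul_right ((Zsqrtd.intCast_dvd_intCast _ _).2 h) _) _

/-- Modulo p every term of the geometric sum is 1. -/
theorem dvd_quot_sub {p : ℤ} {d : ℕ} (h : p ∣ balancing d) (m : ℕ) :
    (p : ℤ√8) ∣ quot d m - m := by
  have : quot d m - m = ∑ j ∈ Finset.range m, ((unit ^ (2 * d)) ^ j - 1) := by
    simp [quot]
  rw [this]
  refine Finset.dvd_sum fun j _ => (dvd_unit_pow_sub_one h).trans ?_
  simpa using sub_dvd_pow_sub_pow (unit ^ (2 * d)) 1 j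

theorem exists_quot_eq {p : ℤ} {d : ℕ} (h : p ∣ balancing d) (m : ℕ) :
    ∃ z : ℤ√8, quot d m = m + p * z := by
  obtain ⟨z, hz⟩ := dvd_quot_sub h m
  exact ⟨z, by rw [← hz]; ring⟩

/-! ### Cyclotomic values and simple primitive prime divisors. -/

/-- The value of the `n`-th cyclotomic polynomial at `(3 + √8) ^ 2`. -/
noncomputable def cyclo (n : ℕ) : ℤ√8 := Polynomial.aeval (unit ^ 2) (Polynomial.cyclotomic n ℤ)

theorem norm_dvd_norm {a b : ℤ√8} (h : a ∣ b) : a.norm ∣ b.norm := by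
  obtain ⟨c, rfl⟩ := h
  exact ⟨_, Zsqrtd.norm_mul _ _⟩

theorem norm_cyclo_dvd (n : ℕ) : (cyclo n).norm ∣ 32 * balancing n ^ 2 := by
  have h : cyclo n ∣ unit ^ (2 * n) - 1 := by
    have := map_dvd (Polynomial.aeval (unit ^ 2)) (Polynomial.cyclotomic.dvd_X_pow_sub_one n ℤ)
    simpa [cyclo, pow_mul] using this
  have h2 := norm_dvd_norm h
  rw [unit_pow_two_mul_sub_one, Zsqrtd.norm_mul, Zsqrtd.norm_mul, Zsqrtd.norm_mul, norm_unit_pow,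
    Zsqrtd.norm_intCast, show (2 : ℤ√8).norm = 4 by decide,
    show (sqrtd : ℤ√8).norm = -8 by decide] at h2
  rw [← dvd_neg]
  have e : -(32 * balancing n ^ 2) = 4 * -8 * (balancing n * balancing n * 1) := by ring
  rwa [e]

theorem cyclo_dvd_quot {d n : ℕ} (hd : d ∈ n.properDivisors) : cyclo n ∣ quot d (n / d) := by
  have := map_dvd (Polynomial.aeval (unit ^ 2)) (cyclotomic_dvd_geom_sum hd)
  simpa [cyclo, quot, pow_mul] using this

/-- Since p ∣ B_d, the quotient is n/d modulo p, so its norm is (n/d)^2 modulo p. As `cyclo n`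
divides the quotient, p divides n/d, hence the quotient itself. Thus p divides both factors B_d and
B_n / B_d. -/
theorem sq_dvd_balancing_of_dvd_norm_cyclo {p n d : ℕ} (hp : p.Prime)
    (hd : d ∈ n.properDivisors) (hpn : (p : ℤ) ∣ (cyclo n).norm) (hpd : (p : ℤ) ∣ balancing d) :
    (p : ℤ) ^ 2 ∣ balancing n := by
  have hp' : Prime (p : ℤ) := Nat.prime_iff_prime_int.1 hp
  obtain ⟨z, hz⟩ := exists_quot_eq hpd (n / d)
  have h1 : (p : ℤ) ∣ (quot d (n / d)).norm := hpn.trans (norm_dvd_norm (cyclo_dvd_quot hd))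
  have h2 : (p : ℤ) ∣ ((n / d : ℕ) : ℤ) ^ 2 := by
    rw [hz, Zsqrtd.norm_def] at h1
    simp only [re_add, im_add, re_mul, im_mul, re_natCast, im_natCast, re_intCast, im_intCast] at h1
    have h := dvd_sub h1 (Dvd.intro ((2 * ((n / d : ℕ) : ℤ) * z.re + p * z.re ^ 2
      - 8 * p * z.im ^ 2)) rfl)
    ring_nf at h ⊢
    exact h
  obtain ⟨m, hm⟩ := hp'.dvd_of_dvd_pow h2
  obtain ⟨b, hb⟩ := hpd
  have h3 := balancing_mul d (n / d)
  rw [Nat.mul_div_cancel' (Nat.mem_properDivisors.1 hd).1, hz] at h3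
  rw [← Zsqrtd.intCast_dvd_intCast (d := 8), h3, hb, ← Int.cast_natCast (n / d), hm]
  push_cast
  exact ⟨b * (unit ^ d * star (unit ^ n) * (m + z)), by ring⟩

/-- `p` divides `B_n` exactly once, and divides no `B_d` with `d` a proper divisor of `n`. -/
structure IsSimplePrimitive (n p : ℕ) : Prop where
  prime : p.Prime
  dvd : (p : ℤ) ∣ balancing n
  not_sq_dvd : ¬ (p : ℤ) ^ 2 ∣ balancing n
  not_dvd : ∀ d ∈ n.properDivisors, ¬ (p : ℤ) ∣ balancing d

theorem IsSimplePrimitive.odd {n p : ℕ} (h : IsSimplePrimitive n p) (hn : 4 ∣ n) : Odd p := by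
  refine h.prime.odd_of_ne_two ?_
  rintro rfl
  refine h.not_sq_dvd (dvd_trans ?_ (balancing_dvd hn))
  -- If p were 2, then 4 ∣ 204 = B_4 ∣ B_n would contradict simplicity.
  rw [show balancing 4 = 204 by decide]
  decide

theorem isSimplePrimitive_of_dvd_norm_cyclo {n p : ℕ} (hn : 4 ∣ n) (hp : p.Prime)
    (hpn : (p : ℤ) ∣ (cyclo n).norm) (hsq : ¬ (p : ℤ) ^ 2 ∣ balancing n) :
    IsSimplePrimitive n p := by
  have hp' : Prime (p : ℤ) := Nat.prime_iff_prime_int.1 hp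
  refine ⟨hp, ?_, hsq, fun d hd hpd => hsq (sq_dvd_balancing_of_dvd_norm_cyclo hp hd hpn hpd)⟩
  have h2 : p ≠ 2 := by
    rintro rfl
    refine hsq (dvd_trans ?_ (balancing_dvd hn))
    rw [show balancing 4 = 204 by decide]
    decide
  rcases hp'.dvd_or_dvd (hpn.trans (norm_cyclo_dvd n)) with h | h
  · rw [show (32 : ℤ) = 2 ^ 5 by norm_num] at h
    have := hp'.dvd_of_dvd_pow h
    exact absurd ((Nat.prime_dvd_prime_iff_eq hp Nat.prime_two).1 (by exact_mod_cast this)) h2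
  · exact hp'.dvd_of_dvd_pow h

/-! ### Index of divisibility, and the law p ∣ B_{p - (8/p)}. -/

theorem not_dvd_two_pow {p : ℕ} (hp : p.Prime) (ho : Odd p) (k : ℕ) : ¬ (p : ℤ) ∣ 2 ^ k := by
  intro h
  have h1 := (Nat.prime_iff_prime_int.1 hp).dvd_of_dvd_pow h
  have h2 := (Nat.prime_dvd_prime_iff_eq hp Nat.prime_two).1 (by exact_mod_cast h1)
  subst h2
  exact absurd ho (by decide)

theorem dvd_balancing_iff {p : ℕ} (hp : p.Prime) (ho : Odd p) (n : ℕ) :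
    (p : ℤ) ∣ balancing n ↔ (p : ℤ√8) ∣ unit ^ (2 * n) - 1 := by
  refine ⟨fun h => by exact_mod_cast dvd_unit_pow_sub_one h, fun h => ?_⟩
  have h1 : (p : ℤ√8) ∣ ((2 ^ 4 * balancing n : ℤ) : ℤ√8) := by
    have e : ((2 ^ 4 * balancing n : ℤ) : ℤ√8) =
        (unit ^ (2 * n) - 1) * (star (unit ^ n) * sqrtd) := by
      have h8 : (sqrtd : ℤ√8) * sqrtd = 8 := by decide
      rw [unit_pow_two_mul_sub_one]
      push_cast
      linear_combination -(2 * (balancing n : ℤ√8) * (sqrtd * sqrtd)) * unit_pow_mul_star n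
        - 2 * (balancing n : ℤ√8) * h8
    rw [e]
    exact h.mul_right _
  have h2 : (p : ℤ) ∣ 2 ^ 4 * balancing n :=
    (Zsqrtd.intCast_dvd_intCast (d := 8) _ _).1 (by exact_mod_cast h1)
  exact ((Nat.prime_iff_prime_int.1 hp).dvd_or_dvd h2).resolve_left (not_dvd_two_pow hp ho 4)

/-- For odd p, p ∣ B_n means that twice n is a multiple of the order of the unit modulo p. -/
theorem dvd_balancing_gcd {p : ℕ} (hp : p.Prime) (ho : Odd p) {a b : ℕ}
    (ha : (p : ℤ) ∣ balancing a) (hb : (p : ℤ) ∣ balancing b) :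
    (p : ℤ) ∣ balancing (a.gcd b) := by
  rw [dvd_balancing_iff hp ho] at *
  let f := Ideal.Quotient.mk (Ideal.span {(p : ℤ√8)})
  have key : ∀ x : ℕ, (p : ℤ√8) ∣ unit ^ (2 * x) - 1 ↔ f unit ^ (2 * x) = 1 := by
    intro x
    rw [← Ideal.mem_span_singleton, ← map_pow, ← map_one f, Ideal.Quotient.eq]
  rw [key, ← orderOf_dvd_iff_pow_eq_one] at *
  rw [← Nat.gcd_mul_left]
  exact Nat.dvd_gcd ha hb

theorem intCast_pow_prime_sub_dvd {p : ℕ} (hp : p.Prime) (a : ℤ) : (p : ℤ) ∣ a ^ p - a := by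
  have := Fact.mk hp
  rw [← ZMod.intCast_zmod_eq_zero_iff_dvd]
  simp

theorem sqrtd_pow_odd (k : ℕ) : (sqrtd : ℤ√8) ^ (2 * k + 1) = ((8 ^ k : ℤ) : ℤ√8) * sqrtd := by
  have h8 : (sqrtd : ℤ√8) ^ 2 = 8 := by decide
  rw [pow_succ, pow_mul, h8]; push_cast; rfl

/-- Frobenius: (3 + √8)^p ≡ 3^p + √8^p modulo p, followed by Fermat for 3. -/
theorem unit_pow_prime {p : ℕ} (hp : p.Prime) (ho : Odd p) :
    (p : ℤ) ∣ (unit ^ p).re - 3 ∧ (p : ℤ) ∣ (unit ^ p).im - 8 ^ (p / 2) := by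
  have hu : unit = ((3 : ℤ) : ℤ√8) + sqrtd := by decide
  obtain ⟨r, hr⟩ := exists_add_pow_prime_eq hp ((3 : ℤ) : ℤ√8) sqrtd
  rw [← hu] at hr
  have h2 : 2 * (p / 2) + 1 = p := Nat.two_mul_div_two_add_one_of_odd ho
  have h3 : (sqrtd : ℤ√8) ^ p = ((8 ^ (p / 2) : ℤ) : ℤ√8) * sqrtd := by
    conv_lhs => rw [← h2]
    exact sqrtd_pow_odd _
  obtain ⟨c, hc⟩ := intCast_pow_prime_sub_dvd hp 3
  have h4 : unit ^ p = ((3 ^ p : ℤ) : ℤ√8) + ((8 ^ (p / 2) : ℤ) : ℤ√8) * sqrtd +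
      ((p : ℤ) : ℤ√8) * (((3 : ℤ) : ℤ√8) * sqrtd * r) := by
    rw [hr, h3]; push_cast; ring
  generalize ((3 : ℤ) : ℤ√8) * sqrtd * r = s at h4
  rw [h4]
  simp only [re_add, im_add, re_mul, im_mul, re_intCast, im_intCast, re_sqrtd, im_sqrtd]
  exact ⟨⟨c + s.re, by linear_combination hc⟩, ⟨s.im, by ring⟩⟩

theorem jacobiSym_eight_cases {p : ℕ} (hp : p.Prime) (ho : Odd p) :
    jacobiSym 8 p = 1 ∨ jacobiSym 8 p = -1 := by
  refine jacobiSym.eq_one_or_neg_one ?_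
  rw [← Int.isCoprime_iff_gcd_eq_one]
  have := (Nat.prime_iff_prime_int.1 hp).coprime_iff_not_dvd.2 (not_dvd_two_pow hp ho 3)
  exact this.symm

theorem dvd_pow_sub_jacobiSym {p : ℕ} (hp : p.Prime) :
    (p : ℤ) ∣ 8 ^ (p / 2) - jacobiSym 8 p := by
  have := Fact.mk hp
  rw [← ZMod.intCast_zmod_eq_zero_iff_dvd, ← jacobiSym.legendreSym.to_jacobiSym]
  push_cast
  rw [legendreSym.eq_pow]
  simp

/-- By Euler's criterion the p-th power of the unit is, modulo p, the unit itself or its conjugate,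
which is its inverse. -/
theorem dvd_balancing_sub_jacobiSym {p : ℕ} (hp : p.Prime) (ho : Odd p) :
    (p : ℤ) ∣ balancing ((p : ℤ) - jacobiSym 8 p).toNat := by
  obtain ⟨⟨a, ha⟩, ⟨b, hb⟩⟩ := unit_pow_prime hp ho
  obtain ⟨c, hc⟩ := dvd_pow_sub_jacobiSym hp
  rcases jacobiSym_eight_cases hp ho with h | h
  · rw [h] at hc ⊢
    have e : ((p : ℤ) - 1).toNat + 1 = p := by have := hp.pos; omega
    have : unit ^ ((p : ℤ) - 1).toNat = unit ^ p * star unit := by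
      conv_rhs => rw [← e, pow_succ, mul_assoc, unit_mul_star, mul_one]
    rw [← im_unit_pow, this, im_mul]
    simp only [unit, im_star, re_star] at *
    exact ⟨-a + 3 * b + 3 * c, by linear_combination -ha + 3 * hb + 3 * hc⟩
  · rw [h] at hc ⊢
    have e : ((p : ℤ) - -1).toNat = p + 1 := by omega
    rw [← im_unit_pow, e, pow_succ, im_mul]
    simp only [unit] at *
    exact ⟨a + 3 * b + 3 * c, by linear_combination ha + 3 * hb + 3 * hc⟩

theorem IsSimplePrimitive.dvd_of_dvd_balancing {n p m : ℕ} (h : IsSimplePrimitive n p)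
    (ho : Odd p) (hn : 0 < n) (hm : (p : ℤ) ∣ balancing m) : n ∣ m := by
  have hg := dvd_balancing_gcd h.prime ho h.dvd hm
  have hdvd := Nat.gcd_dvd_left n m
  by_contra hnm
  refine h.not_dvd _ (Nat.mem_properDivisors.2 ⟨hdvd, ?_⟩) hg
  refine lt_of_le_of_ne (Nat.le_of_dvd hn hdvd) fun e => hnm ?_
  exact Nat.gcd_eq_left_iff_dvd.1 e

theorem jacobiSym_eight_eq_one_of_mod {p : ℕ} (h : p % 8 = 7) : jacobiSym 8 p = 1 := by
  have ho : Odd p := Nat.odd_iff.2 (by omega)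
  have h2 : jacobiSym 2 p = 1 := by
    rw [jacobiSym.at_two ho, ZMod.χ₈_nat_eq_if_mod_eight]
    simp [h, show p % 2 = 1 by omega]
  rw [show (8 : ℤ) = 2 ^ 3 by norm_num, jacobiSym.pow_left, h2, one_pow]

theorem IsSimplePrimitive.jacobiSym_eq_one {n p : ℕ} (h : IsSimplePrimitive n p)
    (hn : 0 < n) (h8 : 8 ∣ n) : jacobiSym 8 p = 1 ∧ n ∣ p - 1 := by
  have ho := h.odd (dvd_trans (by norm_num) h8)
  have hd := h.dvd_of_dvd_balancing ho hn (dvd_balancing_sub_jacobiSym h.prime ho)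
  have hp := h.prime.pos
  rcases jacobiSym_eight_cases h.prime ho with hj | hj
  · rw [hj, show ((p : ℤ) - 1).toNat = p - 1 by omega] at hd
    exact ⟨hj, hd⟩
  · exfalso
    rw [hj] at hd
    -- Here n ∣ p + 1, so p ≡ 7 (mod 8), and then 2 is a square modulo p.
    have h1 := jacobiSym_eight_eq_one_of_mod (p := p) (by have := h8.trans hd; omega)
    rw [hj] at h1
    norm_num at h1

/-- Up to a unit, B_{nm} / B_n is congruent to m modulo p, so it contributes no further factor p. -/
theorem not_sq_dvd_balancing_mul {n m p : ℕ} (hp : p.Prime) (h1 : (p : ℤ) ∣ balancing n)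
    (h2 : ¬ (p : ℤ) ^ 2 ∣ balancing n) (hm : ¬ p ∣ m) :
    ¬ (p : ℤ) ^ 2 ∣ balancing (n * m) := by
  intro h
  have hp' : Prime (p : ℤ) := Nat.prime_iff_prime_int.1 hp
  obtain ⟨z, hz⟩ := exists_quot_eq h1 m
  have e : (balancing n : ℤ√8) * quot n m =
      balancing (n * m) * (unit ^ (n * m) * star (unit ^ n)) := by
    linear_combination -star (unit ^ n) * balancing_mul_unit_pow n m
      - (balancing n : ℤ√8) * quot n m * unit_pow_mul_star n
  have h3 : (((p : ℤ) ^ 2 : ℤ) : ℤ√8) ∣ balancing n * quot n m := by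
    rw [e]
    exact ((Zsqrtd.intCast_dvd_intCast _ _).2 h).mul_right _
  have h4 := ((Zsqrtd.intCast_dvd _ _).1 h3).1
  rw [re_smul, hz] at h4
  simp only [re_add, re_mul, re_natCast, re_intCast, im_intCast] at h4
  obtain ⟨b, hb⟩ := h1
  rw [hb, pow_two, mul_assoc] at h4
  have h5 := (mul_dvd_mul_iff_left hp'.ne_zero).1 h4
  rcases hp'.dvd_or_dvd h5 with h6 | h6
  · exact h2 (by rw [hb, pow_two]; exact mul_dvd_mul_left _ h6)
  · refine hm ?_
    have : (p : ℤ) ∣ (m : ℤ) := by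
      have := dvd_sub h6 (Dvd.intro z.re rfl : (p : ℤ) ∣ p * z.re)
      simpa using this
    exact_mod_cast this

theorem IsSimplePrimitive.isBalancingNonWieferich {n p : ℕ} (h : IsSimplePrimitive n p)
    (hn : 0 < n) (h8 : 8 ∣ n) : IsBalancingNonWieferich p := by
  have ho := h.odd (dvd_trans (by norm_num) h8)
  obtain ⟨hj, m, hm⟩ := h.jacobiSym_eq_one hn h8
  refine ⟨h.prime, ho, ?_⟩
  rw [hj, Int.modEq_zero_iff_dvd]
  have hp := h.prime.two_le
  rw [show ((p : ℤ) - 1).toNat = p - 1 by omega, hm]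
  refine not_sq_dvd_balancing_mul h.prime h.dvd h.not_sq_dvd fun hpm => ?_
  have hm0 : 0 < m := Nat.pos_of_ne_zero (by rintro rfl; omega)
  have h1 := Nat.le_of_dvd hm0 hpm
  have h2 : m ≤ n * m := Nat.le_mul_of_pos_left m hn
  omega

theorem IsSimplePrimitive.modEq_one {n p r : ℕ} (h : IsSimplePrimitive n p)
    (hn : 0 < n) (h8 : 8 ∣ n) (hr : r ∣ n) : p ≡ 1 [MOD r] :=
  ((Nat.modEq_iff_dvd' h.prime.one_le).2 (hr.trans (h.jacobiSym_eq_one hn h8).2)).symm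

theorem IsSimplePrimitive.index_unique {n m p : ℕ} (h : IsSimplePrimitive n p)
    (h' : IsSimplePrimitive m p) (hn : 0 < n) (hm : 0 < m) (h4 : 4 ∣ n) : n = m :=
  Nat.dvd_antisymm (h.dvd_of_dvd_balancing (h.odd h4) hn h'.dvd)
    (h'.dvd_of_dvd_balancing (h.odd h4) hm h.dvd)

end Balancing

/-! ### Bounds for the radical and the height in a number field. -/

section NumberField

open NumberField IsDedekindDomain

variable {K : Type*} [Field K] [NumberField K]

theorem asIdeal_pow_ramificationIdx_dvd_span (v : HeightOneSpectrum (𝓞 K)) {m : ℕ} (hm : m ≠ 0)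
    (hmv : (m : 𝓞 K) ∈ v.asIdeal) :
    v.asIdeal ^ v.asIdeal.ramificationIdx ℤ ∣ Ideal.span {(m : 𝓞 K)} := by
  have hu : (m : ℤ) ∈ v.asIdeal.under ℤ := by
    rw [Ideal.mem_comap]; simpa using hmv
  have hbot : v.asIdeal.under ℤ ≠ ⊥ := by
    intro h
    rw [h, Ideal.mem_bot] at hu
    exact hm (by exact_mod_cast hu)
  rw [Ideal.dvd_iff_le, ← Ideal.ramificationIdx'_eq_ramificationIdx (v.asIdeal.under ℤ) _ hbot]
  refine le_trans ?_ Ideal.le_pow_ramificationIdx'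
  rw [Ideal.span_singleton_le_iff_mem]
  simpa using Ideal.mem_map_of_mem (algebraMap ℤ (𝓞 K)) hu

theorem primeFactors_prod_mem {R : Type*} [CommRing R] (v : HeightOneSpectrum R) {M : ℕ}
    (hM : M ≠ 0) (hMv : (M : R) ∈ v.asIdeal) :
    ((∏ p ∈ M.primeFactors, p : ℕ) : R) ∈ v.asIdeal := by
  have h : M ∣ (∏ p ∈ M.primeFactors, p) ^ M := by
    conv_lhs => rw [← Nat.prod_factorization_pow_eq_self hM]
    rw [Finsupp.prod, Nat.support_factorization, ← Finset.prod_pow]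
    exact Finset.prod_dvd_prod_of_dvd _ _ fun p hp =>
      pow_dvd_pow _ (Nat.factorization_lt p hM).le
  obtain ⟨c, hc⟩ := h
  refine v.isPrime.mem_of_pow_mem M ?_
  rw [← Nat.cast_pow, hc, Nat.cast_mul]
  exact Ideal.mul_mem_right _ _ hMv

/-- The weights are such that the product of the ideals v^e(v) divides the ideal generated by the
squarefree part ∏ p; take norms. -/
theorem prod_absNorm_pow_ramificationIdx_le (S : Finset (HeightOneSpectrum (𝓞 K))) {M : ℕ}
    (hM : M ≠ 0) (hS : ∀ v ∈ S, (M : 𝓞 K) ∈ v.asIdeal) :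
    ∏ v ∈ S, (Ideal.absNorm v.asIdeal : ℝ) ^ v.asIdeal.ramificationIdx ℤ ≤
      ((∏ p ∈ M.primeFactors, p : ℕ) : ℝ) ^ Module.finrank ℚ K := by
  set m := ∏ p ∈ M.primeFactors, p with hm
  have hm0 : m ≠ 0 := Finset.prod_ne_zero_iff.2 fun p hp => (Nat.prime_of_mem_primeFactors hp).ne_zero
  have hdvd : ∏ v ∈ S, v.asIdeal ^ v.asIdeal.ramificationIdx ℤ ∣ Ideal.span {(m : 𝓞 K)} := by
    refine Finset.prod_dvd_of_coprime ?_ fun v hv =>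
      asIdeal_pow_ramificationIdx_dvd_span v hm0 (primeFactors_prod_mem v hM (hS v hv))
    intro v _ w _ hvw
    refine IsCoprime.pow ?_
    rw [Ideal.isCoprime_iff_sup_eq]
    refine Ideal.IsMaximal.coprime_of_ne v.isMaximal w.isMaximal fun h => hvw ?_
    exact HeightOneSpectrum.ext h
  have hn := map_dvd Ideal.absNorm hdvd
  have e : Ideal.absNorm (Ideal.span {(m : 𝓞 K)}) = m ^ Module.finrank ℚ K := by
    rw [Ideal.absNorm_span_natCast, RingOfIntegers.rank]
  rw [e] at hn
  have := Nat.le_of_dvd (pow_pos (Nat.pos_of_ne_zero hm0) _) hn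
  rw [map_prod] at this
  simp only [map_pow] at this
  exact_mod_cast this

/-- The entry -1 makes every local factor at least 1, so a single place bounds the height from
below. -/
theorem le_mulHeight_of_neg_one (w : InfinitePlace K) (a c : K) (ha : 1 ≤ w a) :
    w a ≤ Height.mulHeight ![a, -1, c] := by
  have h0 : (![a, -1, c] : Fin 3 → K) ≠ 0 := fun h => by
    have := congrFun h 1
    simp at this
  rw [NumberField.mulHeight_eq h0]
  have key : ∀ f : AbsoluteValue K ℝ, 1 ≤ ⨆ i, f ((![a, -1, c] : Fin 3 → K) i) := fun f =>
    Finite.le_ciSup_of_le 1 (by simp)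
  have h1 : 1 ≤ ∏ᶠ v : FinitePlace K, ⨆ i, v ((![a, -1, c] : Fin 3 → K) i) :=
    one_le_finprod fun v => key v.1
  have hw : w a ≤ (⨆ i, w ((![a, -1, c] : Fin 3 → K) i)) ^ w.mult := by
    refine le_trans ?_ (le_self_pow₀ (key w.1) w.mult_pos.ne')
    exact Finite.le_ciSup_of_le (f := fun i => w ((![a, -1, c] : Fin 3 → K) i)) 0 (by simp)
  have h2 : w a ≤ ∏ v : InfinitePlace K, (⨆ i, v ((![a, -1, c] : Fin 3 → K) i)) ^ v.mult := by
    classical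
    rw [← Finset.mul_prod_erase _ _ (Finset.mem_univ w)]
    refine hw.trans (le_mul_of_one_le_right ?_ ?_)
    · exact (zero_le_one.trans ha).trans hw
    · exact Finset.prod_induction _ (1 ≤ ·) (fun _ _ => one_le_mul_of_one_le_of_one_le) le_rfl
        fun v _ => one_le_pow₀ (key v.1)
  exact h2.trans (le_mul_of_one_le_right ((zero_le_one.trans ha).trans h2) h1)

end NumberField

/-! ### The abc conjecture applied to powers of the unit. -/

namespace Balancing

open NumberField

theorem finrank_adjoin_sqrt_two_le : Module.finrank ℚ ℚ⟮(√2 : ℝ)⟯ ≤ 2 := by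
  have hm : (Polynomial.X ^ 2 - Polynomial.C 2 : Polynomial ℚ).Monic :=
    Polynomial.monic_X_pow_sub_C _ (by norm_num)
  have h0 : Polynomial.aeval (√2 : ℝ) (Polynomial.X ^ 2 - Polynomial.C 2 : Polynomial ℚ) = 0 := by
    simp
  have hi : IsIntegral ℚ (√2 : ℝ) := ⟨_, hm, h0⟩
  rw [IntermediateField.adjoin.finrank hi]
  refine (Polynomial.natDegree_le_of_dvd (minpoly.dvd _ _ h0) hm.ne_zero).trans ?_
  rw [Polynomial.natDegree_X_pow_sub_C]

theorem exists_ringOfIntegers_sqrt_eight :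
    ∃ s : 𝓞 ℚ⟮(√2 : ℝ)⟯, s * s = ((8 : ℤ) : 𝓞 ℚ⟮(√2 : ℝ)⟯) ∧
      ((s : ℚ⟮(√2 : ℝ)⟯) : ℝ) = √((8 : ℤ) : ℝ) := by
  let t : ℚ⟮(√2 : ℝ)⟯ := 2 * IntermediateField.AdjoinSimple.gen ℚ (√2 : ℝ)
  have ht : (t : ℝ) = 2 * √2 := rfl
  have ht2 : t * t = 8 := by
    apply Subtype.ext
    push_cast
    rw [ht]
    have : √(2 : ℝ) * √2 = 2 := Real.mul_self_sqrt (by norm_num)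
    change 2 * √2 * (2 * √2) = (8 : ℝ)
    linear_combination 4 * this
  have hint : IsIntegral ℤ t := by
    refine ⟨Polynomial.X ^ 2 - Polynomial.C 8, Polynomial.monic_X_pow_sub_C _ (by norm_num), ?_⟩
    simp [pow_two, ht2]
  refine ⟨⟨t, hint⟩, ?_, ?_⟩
  · apply RingOfIntegers.ext
    exact ht2.trans (map_intCast (algebraMap (𝓞 ℚ⟮(√2 : ℝ)⟯) ℚ⟮(√2 : ℝ)⟯) 8).symm
  · change (t : ℝ) = _
    rw [ht]
    rw [show ((8 : ℤ) : ℝ) = 2 ^ 2 * 2 by norm_num, Real.sqrt_mul (by norm_num),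
      Real.sqrt_sq (by norm_num)]

/-- The unit `3 + √8`, as a real number. -/
noncomputable def alpha : ℝ := 3 + √((8 : ℤ) : ℝ)

theorem one_lt_alpha : 1 < alpha := by
  have := Real.sqrt_nonneg ((8 : ℤ) : ℝ)
  rw [alpha]; linarith

theorem balancing_pos {n : ℕ} (hn : 0 < n) : 0 < balancing n := by
  have h : ∀ n, 0 ≤ balancing n ∧ balancing n < balancing (n + 1) := by
    intro n
    induction n with
    | zero => decide
    | succ n ih =>
      rw [show balancing (n + 1 + 1) = 6 * balancing (n + 1) - balancing n from rfl]
      omega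
  obtain ⟨m, rfl⟩ := Nat.exists_eq_succ_of_ne_zero hn.ne'
  exact (h m).1.trans_lt (h m).2

theorem exists_alpha_pow_le (habc : ABCConjecture ℚ⟮(√2 : ℝ)⟯) {ε : ℝ} (hε : 0 < ε) :
    ∃ C : ℝ, 0 < C ∧ ∀ n : ℕ, 0 < n → alpha ^ (2 * n) ≤
      C * (((∏ p ∈ (2 * balancing n).natAbs.primeFactors, p : ℕ) : ℝ) ^ 2) ^ (1 + ε) := by
  obtain ⟨C, hC, h⟩ := habc ε hε
  refine ⟨C, hC, fun n hn => ?_⟩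
  obtain ⟨s, hs, hs'⟩ := exists_ringOfIntegers_sqrt_eight
  let φ : ℤ√8 →+* 𝓞 ℚ⟮(√2 : ℝ)⟯ := Zsqrtd.lift ⟨s, hs⟩
  let ψ : 𝓞 ℚ⟮(√2 : ℝ)⟯ →+* ℝ :=
    (algebraMap ℚ⟮(√2 : ℝ)⟯ ℝ).comp (algebraMap (𝓞 ℚ⟮(√2 : ℝ)⟯) ℚ⟮(√2 : ℝ)⟯)
  have hψu : ψ (φ unit) = alpha := by
    have : φ unit = 3 + s := by simp [φ, unit]
    rw [this, map_add, map_ofNat, alpha, ← hs']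
    rfl
  let a : ℚ⟮(√2 : ℝ)⟯ := algebraMap _ _ (φ (unit ^ (2 * n)))
  let c : ℚ⟮(√2 : ℝ)⟯ := algebraMap _ _ (φ (1 - unit ^ (2 * n)))
  have ha_real : (a : ℝ) = alpha ^ (2 * n) := by
    change ψ (φ _) = _
    rw [map_pow, map_pow, hψu]
  have hgt : 1 < alpha ^ (2 * n) := one_lt_pow₀ one_lt_alpha (by omega)
  have ha : a ≠ 0 := by
    intro h0
    rw [h0] at ha_real
    simp only [ZeroMemClass.coe_zero] at ha_real
    linarith
  have hsum : a + -1 + c = 0 := by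
    simp only [a, c, map_sub, map_one]; ring
  have hc : c ≠ 0 := by
    intro h0
    rw [h0, add_zero, add_neg_eq_zero] at hsum
    rw [hsum] at ha_real
    simp only [OneMemClass.coe_one] at ha_real
    linarith
  have hH : alpha ^ (2 * n) ≤ Height.mulHeight ![a, -1, c] := by
    let w : InfinitePlace ℚ⟮(√2 : ℝ)⟯ :=
      InfinitePlace.mk (Complex.ofRealHom.comp (algebraMap ℚ⟮(√2 : ℝ)⟯ ℝ))
    have hw : w a = alpha ^ (2 * n) := by
      rw [InfinitePlace.apply]
      change ‖((a : ℝ) : ℂ)‖ = _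
      rw [ha_real, Complex.norm_real, Real.norm_of_nonneg (by linarith)]
    rw [← hw]
    exact le_mulHeight_of_neg_one w a c (by rw [hw]; exact hgt.le)
  have hM : (2 * balancing n).natAbs ≠ 0 := by
    have := balancing_pos hn
    omega
  have hbad : ∀ v ∈ badPrimes ℚ⟮(√2 : ℝ)⟯ a (-1) c,
      (((2 * balancing n).natAbs : ℕ) : 𝓞 ℚ⟮(√2 : ℝ)⟯) ∈ v.asIdeal := by
    intro v hv
    by_contra hnot
    refine hv ?_
    have hmem : ∀ k : ℕ, φ (unit ^ k) ∉ v.asIdeal := fun k hk => by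
      have := v.asIdeal.mul_mem_right (φ (star (unit ^ k))) hk
      rw [← map_mul, unit_pow_mul_star, map_one] at this
      exact v.isPrime.one_notMem this
    have hcm : φ (1 - unit ^ (2 * n)) ∉ v.asIdeal := fun hk => by
      -- The multiplier turns 1 - α^(2n) into (2 B_n)^4, so a prime containing it contains 2 B_n.
      have h1 := v.asIdeal.mul_mem_right
        (φ (-(star (unit ^ n) * Zsqrtd.sqrtd * ((balancing n : ℤ√8) ^ 3)))) hk
      rw [← map_mul] at h1
      have e : (1 - unit ^ (2 * n)) *
          -(star (unit ^ n) * Zsqrtd.sqrtd * ((balancing n : ℤ√8) ^ 3)) =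
          (((2 * balancing n) ^ 4 : ℤ) : ℤ√8) := by
        have h8 : (Zsqrtd.sqrtd : ℤ√8) * Zsqrtd.sqrtd = 8 := by decide
        push_cast
        linear_combination (star (unit ^ n) * Zsqrtd.sqrtd * ((balancing n : ℤ√8) ^ 3)) *
          unit_pow_two_mul_sub_one n + 2 * (balancing n : ℤ√8) ^ 4 *
          (Zsqrtd.sqrtd * Zsqrtd.sqrtd) * unit_pow_mul_star n + 2 * (balancing n : ℤ√8) ^ 4 * h8
      rw [e, map_intCast, Int.cast_pow] at h1
      have h2 := v.isPrime.mem_of_pow_mem 4 h1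
      refine hnot ?_
      rw [← Int.cast_natCast, Int.natAbs_of_nonneg (by have := balancing_pos hn; omega)]
      exact h2
    have e1 : FinitePlace.mk v a = 1 := (FinitePlace.norm_eq_one_iff_notMem _ v _).2 (hmem _)
    have e2 : FinitePlace.mk v c = 1 := (FinitePlace.norm_eq_one_iff_notMem _ v _).2 hcm
    have e3 : FinitePlace.mk v (-1 : ℚ⟮(√2 : ℝ)⟯) = 1 := by
      rw [FinitePlace.coe_apply]; simp
    exact ⟨e1.trans e3.symm, e3.trans e2.symm⟩
  set m := ∏ p ∈ (2 * balancing n).natAbs.primeFactors, p with hm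
  have hm1 : 1 ≤ m := Nat.one_le_iff_ne_zero.2 <|
    Finset.prod_ne_zero_iff.2 fun p hp => (Nat.prime_of_mem_primeFactors hp).ne_zero
  have hrad : radTriple ℚ⟮(√2 : ℝ)⟯ a (-1) c ≤ (m : ℝ) ^ 2 := by
    have hfin := finite_badPrimes ℚ⟮(√2 : ℝ)⟯ ha (neg_ne_zero.2 one_ne_zero) hc
    rw [radTriple, finprod_mem_eq_finite_toFinset_prod _ hfin]
    refine (prod_absNorm_pow_ramificationIdx_le _ hM fun v hv =>
      hbad v (hfin.mem_toFinset.1 hv)).trans ?_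
    exact pow_le_pow_right₀ (by exact_mod_cast hm1) finrank_adjoin_sqrt_two_le
  have hrad0 : 0 ≤ radTriple ℚ⟮(√2 : ℝ)⟯ a (-1) c :=
    finprod_nonneg fun v => finprod_nonneg fun _ => by positivity
  calc alpha ^ (2 * n) ≤ Height.mulHeight ![a, -1, c] := hH
    _ ≤ C * radTriple ℚ⟮(√2 : ℝ)⟯ a (-1) c ^ (1 + ε) :=
      h a (-1) c ha (neg_ne_zero.2 one_ne_zero) hc hsum
    _ ≤ _ := by gcongr

end Balancing

/-! ### Size of the cyclotomic norm and of B_n. -/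

/-- If every prime factor of a divisor `N` of `32 * b ^ 2` divides `b` at least twice, then `N` is
bounded by the fourth power of the quotient of `b` by its radical, up to a constant. -/
theorem mul_prod_primeFactors_pow_le {N b : ℕ} (hb : b ≠ 0) (hN : N ∣ 32 * b ^ 2)
    (h : ∀ p : ℕ, p.Prime → p ∣ N → p ^ 2 ∣ b) :
    N * (∏ p ∈ b.primeFactors, p) ^ 4 ≤ 32 * b ^ 4 := by
  have hb2 : 32 * b ^ 2 ≠ 0 := by positivity
  have hN0 : N ≠ 0 := by rintro rfl; exact hb2 (zero_dvd_iff.1 hN)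
  set R := ∏ p ∈ b.primeFactors, p with hR
  have hR0 : R ≠ 0 := Finset.prod_ne_zero_iff.2 fun p hp => (Nat.prime_of_mem_primeFactors hp).ne_zero
  have hsq : Squarefree R := by
    rw [hR, ← Nat.radical_eq_prod_primeFactors]
    exact UniqueFactorizationMonoid.squarefree_radical
  have hRb : R ∣ b := Nat.prod_primeFactors_dvd b
  refine Nat.le_of_dvd (by positivity) ?_
  rw [← Nat.factorization_le_iff_dvd (by positivity) (by positivity)]
  intro p
  rw [Nat.factorization_mul hN0 (by positivity), Nat.factorization_mul (by norm_num) (by positivity),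
    Nat.factorization_pow, Nat.factorization_pow]
  simp only [Finsupp.add_apply, Finsupp.smul_apply, smul_eq_mul]
  have h1 := (Nat.factorization_le_iff_dvd hN0 hb2).2 hN p
  rw [Nat.factorization_mul (by norm_num) (by positivity), Nat.factorization_pow] at h1
  simp only [Finsupp.add_apply, Finsupp.smul_apply, smul_eq_mul] at h1
  have h2 : R.factorization p ≤ 1 := hsq.natFactorization_le_one p
  have h3 := (Nat.factorization_le_iff_dvd hR0 hb).2 hRb p
  by_cases hp : p.Prime
  · by_cases hpN : p ∣ N
    -- With e the exponent of p in b, e ≥ 2 gives 2e + 4 ≤ 4e; this is where the fourth power comes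
    -- from.
    · have := (hp.pow_dvd_iff_le_factorization hb).1 (h p hp hpN)
      omega
    · rw [Nat.factorization_eq_zero_of_not_dvd hpN]
      omega
  · rw [Nat.factorization_eq_zero_of_not_prime N hp]
    omega

open Polynomial in
theorem pow_totient_le_norm_eval_cyclotomic {n : ℕ} {z : ℂ} {c : ℝ} (hc : 0 ≤ c)
    (h : ∀ ζ : ℂ, ‖ζ‖ = 1 → c ≤ ‖z - ζ‖) :
    c ^ n.totient ≤ ‖(cyclotomic n ℂ).eval z‖ := by
  rcases Nat.eq_zero_or_pos n with rfl | hn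
  · simp
  have hζ := Complex.isPrimitiveRoot_exp n hn.ne'
  rw [cyclotomic_eq_prod_X_sub_primitiveRoots hζ, eval_prod, norm_prod,
    ← Complex.card_primitiveRoots n, ← Finset.prod_const]
  refine Finset.prod_le_prod (fun _ _ => hc) fun ζ hζ => ?_
  simpa using h ζ (((mem_primitiveRoots hn).1 hζ).norm'_eq_one hn.ne')

namespace Balancing

open Zsqrtd

theorem sqrt_eight_mul_self : √((8 : ℤ) : ℝ) * √((8 : ℤ) : ℝ) = 8 := by
  rw [Real.mul_self_sqrt] <;> norm_num

theorem sqrt_eight_lt_three : √((8 : ℤ) : ℝ) < 3 := by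
  nlinarith [sqrt_eight_mul_self, Real.sqrt_nonneg ((8 : ℤ) : ℝ)]

open Polynomial in
theorem map_cyclo (f : ℤ√8 →+* ℂ) (n : ℕ) : f (cyclo n) = (cyclotomic n ℂ).eval (f unit ^ 2) := by
  have h := aeval_algHom_apply f.toIntAlgHom (unit ^ 2) (cyclotomic n ℤ)
  have h2 : f (cyclo n) = f.toIntAlgHom (aeval (unit ^ 2) (cyclotomic n ℤ)) := rfl
  rw [h2, ← h, aeval_def, eval₂_eq_eval_map, map_cyclotomic]
  simp

/-- The two conjugates α^2 > 1 and α^(-2) < 1 keep distances at least α^2 - 1 and 1 - α^(-2) from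
the unit circle, and the product of these distances is 32. -/
theorem pow_totient_le_abs_norm_cyclo (n : ℕ) :
    (32 : ℝ) ^ n.totient ≤ |((cyclo n).norm : ℝ)| := by
  set s := √((8 : ℤ) : ℝ) with hs
  have hss : s * s = 8 := sqrt_eight_mul_self
  have hs0 : 0 ≤ s := Real.sqrt_nonneg _
  have hs3 : s < 3 := sqrt_eight_lt_three
  let f : ℤ√8 →+* ℂ := Complex.ofRealHom.comp (Zsqrtd.toReal (by norm_num))
  let g : ℤ√8 →+* ℂ := f.comp (starRingEnd (ℤ√8))
  have hf : f unit = ((3 + s : ℝ) : ℂ) := by simp [f, unit, hs]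
  have hg : g unit = ((3 - s : ℝ) : ℂ) := by
    have : (starRingEnd (ℤ√8)) unit = ⟨3, -1⟩ := rfl
    simp [g, f, this, hs, sub_eq_add_neg]
  have hfg : f (cyclo n) * g (cyclo n) = (((cyclo n).norm : ℝ) : ℂ) := by
    have : g (cyclo n) = f (star (cyclo n)) := rfl
    rw [this, ← map_mul, ← Zsqrtd.norm_eq_mul_conj, map_intCast]
    simp
  have h1 : ((3 + s) ^ 2 - 1) ^ n.totient ≤ ‖f (cyclo n)‖ := by
    rw [map_cyclo, hf]
    refine pow_totient_le_norm_eval_cyclotomic (by nlinarith) fun ζ hζ => ?_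
    have := norm_sub_norm_le (((3 + s : ℝ) : ℂ) ^ 2) ζ
    rw [← Complex.ofReal_pow]
    rwa [hζ, ← Complex.ofReal_pow, Complex.norm_real, Real.norm_of_nonneg (by positivity)] at this
  have h2 : (1 - (3 - s) ^ 2) ^ n.totient ≤ ‖g (cyclo n)‖ := by
    rw [map_cyclo, hg]
    refine pow_totient_le_norm_eval_cyclotomic (by nlinarith) fun ζ hζ => ?_
    have := norm_sub_norm_le ζ (((3 - s : ℝ) : ℂ) ^ 2)
    rw [← Complex.ofReal_pow]
    rwa [hζ, ← Complex.ofReal_pow, Complex.norm_real, Real.norm_of_nonneg (by positivity),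
      norm_sub_rev] at this
  rw [← Real.norm_eq_abs, ← Complex.norm_real, ← hfg, _root_.norm_mul]
  refine le_trans (le_of_eq ?_) (mul_le_mul h1 h2 (pow_nonneg (by nlinarith) _) (norm_nonneg _))
  rw [← mul_pow]
  congr 1
  linear_combination (s * s - 12) * hss

theorem balancing_nonneg (n : ℕ) : 0 ≤ balancing n := by
  rcases Nat.eq_zero_or_pos n with rfl | hn
  · exact le_rfl
  · exact (balancing_pos hn).le

theorem re_unit_pow_nonneg (n : ℕ) : 0 ≤ (unit ^ n).re := by
  induction n with
  | zero => simp
  | succ n ih =>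
    have := balancing_nonneg n
    rw [pow_succ, re_mul, im_unit_pow, show unit.re = 3 from rfl, show unit.im = 1 from rfl]
    omega

theorem balancing_le_alpha_pow (n : ℕ) : (balancing n : ℝ) ≤ alpha ^ n := by
  have h : Zsqrtd.toReal (by norm_num) unit = alpha := by simp [unit, alpha]
  have h1 : (0 : ℝ) ≤ (unit ^ n).re := by exact_mod_cast re_unit_pow_nonneg n
  have h2 : (0 : ℝ) ≤ balancing n := by exact_mod_cast balancing_nonneg n
  have h3 : 1 ≤ √((8 : ℤ) : ℝ) := by
    rw [Real.one_le_sqrt]; norm_num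
  rw [← h, ← map_pow, Zsqrtd.toReal_apply, im_unit_pow]
  nlinarith

theorem alpha_le : alpha ≤ 32 := by
  have := sqrt_eight_lt_three
  rw [alpha]; linarith

theorem log_alpha_pos : 0 < Real.log alpha := Real.log_pos one_lt_alpha

/-! ### Existence of simple primitive divisors under abc. -/

theorem exists_isSimplePrimitive (habc : ABCConjecture ℚ⟮(√2 : ℝ)⟯) {δ : ℝ} (hδ : 0 < δ) :
    ∃ n₀ : ℕ, ∀ n : ℕ, n₀ ≤ n → 8 ∣ n → δ * n ≤ n.totient → ∃ p, IsSimplePrimitive n p := by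
  -- With this ε, the loss in abc costs at most half of the main term δ n log α.
  obtain ⟨C, hC, hbound⟩ := exists_alpha_pow_le habc (ε := δ / 8) (by positivity)
  have hL := log_alpha_pos
  set L := Real.log alpha with hLdef
  refine ⟨⌈2 * (Real.log 32 + 2 * Real.log C) / (δ * L)⌉₊ + 1, fun n hn h8 hφ => ?_⟩
  by_contra hno
  push Not at hno
  have hn0 : 0 < n := by omega
  have h4 : 4 ∣ n := dvd_trans (by norm_num) h8
  have hBpos := balancing_pos hn0
  set b := (balancing n).natAbs with hb
  have hbB : (b : ℤ) = balancing n := Int.natAbs_of_nonneg hBpos.le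
  have hb0 : b ≠ 0 := by omega
  have h2b : 2 ∣ b := by
    have : (2 : ℤ) ∣ balancing n := dvd_trans (by decide) (balancing_dvd h4)
    omega
  have hbR : (b : ℝ) = balancing n := by exact_mod_cast hbB
  set N := (cyclo n).norm.natAbs with hN
  set R := ∏ p ∈ b.primeFactors, p with hR
  have hR0 : R ≠ 0 := Finset.prod_ne_zero_iff.2 fun p hp => (Nat.prime_of_mem_primeFactors hp).ne_zero
  have hNdvd : N ∣ 32 * b ^ 2 := by
    have := Int.natAbs_dvd_natAbs.2 (norm_cyclo_dvd n)
    rwa [Int.natAbs_mul, Int.natAbs_pow] at this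
  have hNR : N * R ^ 4 ≤ 32 * b ^ 4 := by
    refine mul_prod_primeFactors_pow_le hb0 hNdvd fun p hp hpN => ?_
    by_contra hsq
    refine hno p (isSimplePrimitive_of_dvd_norm_cyclo h4 hp (Int.natCast_dvd.2 hpN) ?_)
    rw [← hbB]
    exact_mod_cast hsq
  have hlow : (32 : ℝ) ^ n.totient ≤ N := by
    rw [hN, Nat.cast_natAbs]
    simpa using pow_totient_le_abs_norm_cyclo n
  have hNpos : (0 : ℝ) < N := lt_of_lt_of_le (by positivity) hlow
  have hRpos : (0 : ℝ) < R := by exact_mod_cast Nat.pos_of_ne_zero hR0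
  have hbpos : (0 : ℝ) < b := by exact_mod_cast Nat.pos_of_ne_zero hb0
  have hup := hbound n hn0
  have hpf : (2 * balancing n).natAbs.primeFactors = b.primeFactors := by
    rw [Int.natAbs_mul, Nat.primeFactors_mul (by norm_num) hb0]
    exact Finset.union_eq_right.2 (Nat.primeFactors_mono h2b hb0)
  rw [hpf, ← hR] at hup
  have l1 : 2 * n * L ≤ Real.log C + (1 + δ / 8) * (2 * Real.log R) := by
    have := Real.log_le_log (pow_pos (zero_lt_one.trans one_lt_alpha) _) hup
    rw [Real.log_pow, Real.log_mul hC.ne' (by positivity), Real.log_rpow (by positivity),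
      Real.log_pow] at this
    push_cast at this
    exact this
  have l2 : Real.log b ≤ n * L := by
    rw [hbR, hLdef, ← Real.log_pow]
    exact Real.log_le_log (hbR ▸ hbpos) (balancing_le_alpha_pow n)
  have l3 : Real.log R ≤ Real.log b := by
    refine Real.log_le_log hRpos ?_
    exact_mod_cast Nat.le_of_dvd (Nat.pos_of_ne_zero hb0) (Nat.prod_primeFactors_dvd b)
  have l4 : Real.log N + 4 * Real.log R ≤ Real.log 32 + 4 * Real.log b := by
    have h : (N : ℝ) * (R : ℝ) ^ 4 ≤ 32 * (b : ℝ) ^ 4 := by exact_mod_cast hNR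
    have := Real.log_le_log (by positivity) h
    rw [Real.log_mul hNpos.ne' (by positivity), Real.log_mul (by norm_num) (by positivity),
      Real.log_pow, Real.log_pow] at this
    exact_mod_cast this
  have l5 : δ * n * L ≤ Real.log N := by
    have h1 := Real.log_le_log (by positivity) hlow
    rw [Real.log_pow] at h1
    have h2 : L ≤ Real.log 32 := Real.log_le_log (zero_lt_one.trans one_lt_alpha) alpha_le
    calc δ * n * L ≤ n.totient * L := by gcongr
      _ ≤ n.totient * Real.log 32 := by gcongr
      _ ≤ _ := h1
  have l6 : δ / 8 * Real.log R ≤ δ / 8 * (n * L) := by gcongr; exact l3.trans l2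
  have l7 : (δ * L) * n ≤ 2 * (Real.log 32 + 2 * Real.log C) := by nlinarith
  have l8 := Nat.le_ceil (2 * (Real.log 32 + 2 * Real.log C) / (δ * L))
  have l9 : ((⌈2 * (Real.log 32 + 2 * Real.log C) / (δ * L)⌉₊ : ℕ) : ℝ) + 1 ≤ n := by
    exact_mod_cast hn
  have l10 : (n : ℝ) ≤ 2 * (Real.log 32 + 2 * Real.log C) / (δ * L) := by
    rw [le_div_iff₀ (by positivity)]; linarith
  linarith

end Balancing

/-! ### Integers with large totient. -/

open Nat in
theorem half_le_sum_totient_div (Y : ℕ) :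
    (Y : ℝ) / 2 ≤ ∑ k ∈ Finset.Icc 1 Y, (φ k : ℝ) / k := by
  rcases Nat.eq_zero_or_pos Y with rfl | hY
  · simp
  -- Sum k = ∑_{d ∣ k} φ(d) over k ≤ Y and interchange the order.
  have h1 : ∑ k ∈ Finset.Icc 1 Y, k = ∑ d ∈ Finset.Icc 1 Y, φ d * (Y / d) := by
    calc ∑ k ∈ Finset.Icc 1 Y, k
        = ∑ k ∈ Finset.Icc 1 Y, ∑ d ∈ Finset.Icc 1 Y, if d ∣ k then φ d else 0 := by
          refine Finset.sum_congr rfl fun k hk => ?_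
          rw [Finset.mem_Icc] at hk
          conv_lhs => rw [← Nat.sum_totient k]
          rw [← Finset.sum_filter]
          refine Finset.sum_congr ?_ fun _ _ => rfl
          ext d
          simp only [Nat.mem_divisors, Finset.mem_filter, Finset.mem_Icc]
          constructor
          · rintro ⟨h, h0⟩
            exact ⟨⟨Nat.pos_of_dvd_of_pos h (by omega), (Nat.le_of_dvd (by omega) h).trans hk.2⟩, h⟩
          · rintro ⟨_, h⟩
            exact ⟨h, by omega⟩
      _ = ∑ d ∈ Finset.Icc 1 Y, ∑ k ∈ Finset.Icc 1 Y, if d ∣ k then φ d else 0 :=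
          Finset.sum_comm
      _ = _ := by
          refine Finset.sum_congr rfl fun d _ => ?_
          rw [← Finset.sum_filter, Finset.sum_const, smul_eq_mul, mul_comm]
          congr 1
          exact Nat.Ioc_filter_dvd_card_eq_div Y d
  have h2 : (Y : ℝ) * (Y + 1) / 2 = ∑ k ∈ Finset.Icc 1 Y, (k : ℝ) := by
    have h := Finset.sum_range_id_mul_two (Y + 1)
    have e : ∑ k ∈ Finset.Icc 1 Y, k = ∑ k ∈ Finset.range (Y + 1), k := by
      rw [Finset.sum_range_succ', add_zero]
      rw [Finset.range_eq_Ico, Finset.sum_Ico_add' (fun x => x) 0 Y 1]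
      rfl
    rw [← e] at h
    have : ((∑ k ∈ Finset.Icc 1 Y, k : ℕ) : ℝ) * 2 = (Y + 1) * Y := by exact_mod_cast h
    push_cast at this
    linarith
  have h3 : ∑ k ∈ Finset.Icc 1 Y, (k : ℝ) ≤ Y * ∑ k ∈ Finset.Icc 1 Y, (φ k : ℝ) / k := by
    have : ∑ k ∈ Finset.Icc 1 Y, (k : ℝ) = ∑ d ∈ Finset.Icc 1 Y, (φ d : ℝ) * ((Y / d : ℕ) : ℝ) := by
      have := congrArg (Nat.cast (R := ℝ)) h1
      simpa only [Nat.cast_sum, Nat.cast_mul] using this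
    rw [this, Finset.mul_sum]
    refine Finset.sum_le_sum fun d _ => ?_
    calc (φ d : ℝ) * ((Y / d : ℕ) : ℝ) ≤ φ d * ((Y : ℝ) / d) := by
          gcongr; exact Nat.cast_div_le
      _ = _ := by ring
  have hY' : (0 : ℝ) < Y := by exact_mod_cast hY
  rw [← h2] at h3
  have : (Y : ℝ) * (Y / 2) ≤ Y * ∑ k ∈ Finset.Icc 1 Y, (φ k : ℝ) / k := by
    refine le_trans ?_ h3
    nlinarith
  exact le_of_mul_le_mul_left this hY'

open Nat in
-- The ratios φ(k)/k have mean at least 1/2; each is at most 1, and those outside the set are below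
-- 1/4.
theorem quarter_le_card_totient_large (Y : ℕ) :
    (Y : ℝ) / 4 ≤ ((Finset.Icc 1 Y).filter fun k => k ≤ 4 * φ k).card := by
  have h := half_le_sum_totient_div Y
  have h2 : ∑ k ∈ Finset.Icc 1 Y, (φ k : ℝ) / k ≤
      ∑ k ∈ Finset.Icc 1 Y, ((if k ≤ 4 * φ k then 1 else 0) + 1 / 4 : ℝ) := by
    refine Finset.sum_le_sum fun k hk => ?_
    have hk0 : (0 : ℝ) < k := by exact_mod_cast (Finset.mem_Icc.1 hk).1
    rw [div_le_iff₀ hk0]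
    have h1 : (φ k : ℝ) ≤ k := by exact_mod_cast Nat.totient_le k
    split_ifs with hc
    · nlinarith
    · have : (4 * φ k : ℝ) < k := by exact_mod_cast not_le.1 hc
      linarith
  rw [Finset.sum_add_distrib, Finset.sum_boole, Finset.sum_const, Nat.card_Icc] at h2
  simp only [nsmul_eq_mul, Nat.add_sub_cancel] at h2
  linarith

/-! ### Counting the primes. -/

namespace Balancing

theorem IsSimplePrimitive.le_alpha_pow {n p : ℕ} (h : IsSimplePrimitive n p) (hn : 0 < n) :
    (p : ℝ) ≤ alpha ^ n := by
  refine le_trans ?_ (balancing_le_alpha_pow n)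
  exact_mod_cast Int.le_of_dvd (balancing_pos hn) h.dvd

open Nat in
theorem mul_le_totient_of_le_four_mul {r k : ℕ} (hr : 0 < r) (hk : k ≤ 4 * φ k) :
    1 / (32 * r : ℝ) * ((8 * r * k : ℕ) : ℝ) ≤ φ (8 * r * k) := by
  have h1 : φ k ≤ φ (8 * r * k) :=
    (Nat.le_mul_of_pos_left _ (Nat.totient_pos.2 (by positivity))).trans
      (Nat.totient_super_multiplicative (8 * r) k)
  have h2 : (k : ℝ) ≤ 4 * φ (8 * r * k) := by exact_mod_cast hk.trans (by omega)
  have hr' : (0 : ℝ) < r := by exact_mod_cast hr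
  push_cast
  rw [show 1 / (32 * r : ℝ) * (8 * r * k) = k / 4 by field_simp; ring]
  linarith

theorem exists_mul_log_le_balancingNonWieferichCount (r : ℕ) (hr : 2 ≤ r) (habc : ABCConjecture ℚ⟮(√2 : ℝ)⟯) :
    ∃ c : ℝ, 0 < c ∧ ∃ x₀ : ℝ, ∀ x : ℝ, x₀ ≤ x →
      c * Real.log x ≤ (balancingNonWieferichCount r x : ℝ) := by
  have hr0 : (0 : ℝ) < r := by exact_mod_cast (by omega : 0 < r)
  obtain ⟨n₀, hn₀⟩ := exists_isSimplePrimitive habc (δ := 1 / (32 * r)) (by positivity)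
  have hL := log_alpha_pos
  set L := Real.log alpha with hLdef
  set A : ℝ := 8 * r * L with hA
  have hA0 : 0 < A := by positivity
  -- The count is at least Y/4 - n₀ with Y > log x / A - 1. The threshold makes n₀ + 1/4 at most
  -- half of log x / (4A), leaving log x / (8A).
  refine ⟨1 / (8 * A), by positivity, Real.exp ((n₀ + 1 / 4) * (8 * A)), fun x hx => ?_⟩
  have hx0 : 0 < x := (Real.exp_pos _).trans_le hx
  have hlog : (n₀ + 1 / 4) * (8 * A) ≤ Real.log x := (Real.le_log_iff_exp_le hx0).2 hx
  have hlog0 : 0 ≤ Real.log x := le_trans (by positivity) hlog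
  set Y := ⌊Real.log x / A⌋₊ with hY
  have hYle : (Y : ℝ) * A ≤ Real.log x := by
    rw [← le_div_iff₀ hA0]; exact Nat.floor_le (by positivity)
  have hYlt : Real.log x / A < Y + 1 := Nat.lt_floor_add_one _
  let S := (Finset.Icc 1 Y).filter fun k => k ≤ 4 * k.totient
  let T := S \ Finset.range n₀
  have hcard : (Y : ℝ) / 4 - n₀ ≤ T.card := by
    have h1 := quarter_le_card_totient_large Y
    have h2 : S.card ≤ T.card + n₀ := by
      have := Finset.card_le_card_sdiff_add_card (s := S) (t := Finset.range n₀)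
      rwa [Finset.card_range] at this
    have h3 : (S.card : ℝ) ≤ T.card + n₀ := by exact_mod_cast h2
    change (Y : ℝ) / 4 ≤ (S.card : ℝ) at h1
    linarith
  have hex : ∀ k ∈ T, ∃ p, IsSimplePrimitive (8 * r * k) p := by
    intro k hk
    simp only [T, S, Finset.mem_sdiff, Finset.mem_filter, Finset.mem_Icc, Finset.mem_range,
      not_lt] at hk
    refine hn₀ _ ?_ ⟨r * k, by ring⟩ (mul_le_totient_of_le_four_mul (by omega) hk.1.2)
    exact hk.2.trans (Nat.le_mul_of_pos_left k (by omega))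
  choose! P hP using hex
  have hpos : ∀ k ∈ T, 0 < 8 * r * k := fun k hk => by
    have : 1 ≤ k := by
      simp only [T, S, Finset.mem_sdiff, Finset.mem_filter, Finset.mem_Icc] at hk
      exact hk.1.1.1
    have : 0 < r := by omega
    positivity
  have hle : ∀ k ∈ T, (P k : ℝ) ≤ x := fun k hk => by
    refine ((hP k hk).le_alpha_pow (hpos k hk)).trans ?_
    have hkY : (k : ℝ) ≤ Y := by
      simp only [T, S, Finset.mem_sdiff, Finset.mem_filter, Finset.mem_Icc] at hk
      exact_mod_cast hk.1.1.2
    rw [← Real.log_le_log_iff (pow_pos (zero_lt_one.trans one_lt_alpha) _) hx0, Real.log_pow]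
    refine le_trans ?_ hYle
    push_cast
    calc 8 * (r : ℝ) * k * Real.log alpha = k * A := by rw [hA]; ring
      _ ≤ Y * A := by gcongr
  have hinj : Set.InjOn P T := by
    intro k hk l hl hkl
    have h1 := hP k hk
    rw [hkl] at h1
    have := h1.index_unique (hP l hl) (hpos k hk) (hpos l hl) ⟨2 * r * k, by ring⟩
    exact Nat.eq_of_mul_eq_mul_left (by omega) this
  have hfin : {p : ℕ | (p : ℝ) ≤ x ∧ p ≡ 1 [MOD r] ∧ IsBalancingNonWieferich p}.Finite :=
    (Set.finite_Iic ⌊x⌋₊).subset fun p hp => Nat.le_floor hp.1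
  have hcount : T.card ≤ balancingNonWieferichCount r x := by
    rw [← Finset.card_image_of_injOn hinj, ← Set.ncard_coe_finset]
    refine Set.ncard_le_ncard (fun p hp => ?_) hfin
    obtain ⟨k, hk, rfl⟩ := Finset.mem_image.1 (Finset.mem_coe.1 hp)
    have h8 : 8 ∣ 8 * r * k := ⟨r * k, by ring⟩
    exact ⟨hle k hk, (hP k hk).modEq_one (hpos k hk) h8 ⟨8 * k, by ring⟩,
      (hP k hk).isBalancingNonWieferich (hpos k hk) h8⟩
  have hcount' : (T.card : ℝ) ≤ balancingNonWieferichCount r x := by exact_mod_cast hcount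
  have e1 : 1 / (8 * A) * Real.log x = Real.log x / A / 8 := by field_simp
  have e2 : (n₀ + 1 / 4 : ℝ) ≤ Real.log x / A / 8 := by
    rw [div_div, le_div_iff₀ (by positivity)]; linarith
  rw [e1]
  linarith

end Balancing

theorem theorem1 (r : ℕ) (hr : 2 ≤ r) (habc : ABCConjecture ℚ⟮(√2 : ℝ)⟯) :
    ∃ c : ℝ, 0 < c ∧ ∃ x₀ : ℝ, ∀ x : ℝ, x₀ ≤ x →
      c * Real.log x ≤ (balancingNonWieferichCount r x : ℝ) := by
  exact Balancing.exists_mul_log_le_balancingNonWieferichCount r hr habc
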